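/- Let $X\in\mathbb{R}^{N\times d}$ have rank $r$ and let $X=U\Sigma V^{\mathsf T}$ be a singular value decomposition, where $U\in\mathbb{R}^{N\times r}$ and $V\in\mathbb{R}^{d\times r}$ have orthonormal columns and $\Sigma\in\mathbb{R}^{r\times r}$ is diagonal with positive diagonal entries $\sigma_1\ge\dots\ge\sigma_r>0$. Let $1\le k\le r$ and let $V_k=V_{:,[k]}\in\mathbb{R}^{d\times k}$ consist of the first $k$ columns of $V$. For $\nu\in\{2,\mathrm{Fr}\}$ let $\|\cdot\|_\nu$ be the spectral norm, respectively the Frobenius norm. Let $\Pi_kX$ be a best approximation of $X$ among the matrices of rank at most $k$, where "best" may be understood in either of the two norms. For $S\subset[d]$ with $|S|=k$ let $\Pi_S^\nu X$ be a minimizer of $\|X-A\|_\nu$ over all the matrices $A=X_{:,S}B$ with $B\in\mathbb{R}^{k\times d}$ and $\operatorname{rank}B\le k$. There is a determinantal point process on $[d]$ with marginal kernel $K=V_kV_k^{\mathsf T}$, that is, a random subset $S$ of $[d]$ such that $\mathbb{P}(T\subset S)=\det\big((K_{i,j})_{i,j\in T}\big)$ for all $T\subset[d]$. Every such random subset satisfies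 $|S|=k$ almost surely and $$\mathbb{P}(S=T)=\det(V_{T,[k]})^2\qquad\text{for all } T\subset[d] \text{ with } |T|=k,$$ and, for both $\nu\in\{2,\mathrm{Fr}\}$, $$\mathbb{E}\,\|X-\Pi_S^\nu X\|_\nu^2\le k(d+1-k)\,\|X-\Pi_kX\|_\nu^2 .$$ -/

import Mathlib

/-- The two matrix norms under consideration. -/
inductive NormKind where
  | spectral
  | frobenius

/-- The spectral norm (the operator norm between Euclidean spaces, i.e. the largest singular value)
or the Frobenius norm of a real matrix. -/
noncomputable def matNorm {m n : ℕ} (ν : NormKind) (A : Matrix (Fin m) (Fin n) ℝ) : ℝ :=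
  match ν with
  | .spectral => Matrix.instL2OpNormedAddCommGroup.toNorm.norm A
  | .frobenius => Matrix.frobeniusNormedAddCommGroup.toNorm.norm A

/-- `X = U Σ Vᵀ` is a (compact) singular value decomposition of `X`: the columns of `U` and of `V`
are orthonormal, and `Σ` is the diagonal matrix of the positive singular values `σ`, in
non-increasing order; in particular `r` is the rank of `X`. -/
structure IsSVD {N d r : ℕ} (X : Matrix (Fin N) (Fin d) ℝ) (U : Matrix (Fin N) (Fin r) ℝ)
    (σ : Fin r → ℝ) (V : Matrix (Fin d) (Fin r) ℝ) : Prop where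
  orthonormal_left : U.transpose * U = 1
  orthonormal_right : V.transpose * V = 1
  pos : ∀ i, 0 < σ i
  antitone : Antitone σ
  eq : X = U * Matrix.diagonal σ * V.transpose

/-- `A` is a best approximation of `X` by matrices of rank at most `k`, for the norm `ν`. -/
def IsBestRankApprox {N d : ℕ} (ν : NormKind) (k : ℕ) (X A : Matrix (Fin N) (Fin d) ℝ) : Prop :=
  A.rank ≤ k ∧
    ∀ A' : Matrix (Fin N) (Fin d) ℝ, A'.rank ≤ k → matNorm ν (X - A) ≤ matNorm ν (X - A')

/-- The submatrix of the columns of `X` with index in `S`. -/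
def colSubmatrix {N d : ℕ} (X : Matrix (Fin N) (Fin d) ℝ) (S : Finset (Fin d)) :
    Matrix (Fin N) S ℝ :=
  X.submatrix id (fun i : S => (i : Fin d))

/-- `A` minimizes `‖X - A‖_ν` over all the matrices `A = X_{:,S} B` with `rank B ≤ k`. -/
def IsBestColumnApprox {N d : ℕ} (ν : NormKind) (k : ℕ) (X : Matrix (Fin N) (Fin d) ℝ)
    (S : Finset (Fin d)) (A : Matrix (Fin N) (Fin d) ℝ) : Prop :=
  (∃ B : Matrix S (Fin d) ℝ, B.rank ≤ k ∧ A = colSubmatrix X S * B) ∧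
    ∀ B : Matrix S (Fin d) ℝ, B.rank ≤ k →
      matNorm ν (X - A) ≤ matNorm ν (X - colSubmatrix X S * B)

/-- `V_k`, the first `k` columns of `V`. -/
def firstCols {d r k : ℕ} (hkr : k ≤ r) (V : Matrix (Fin d) (Fin r) ℝ) :
    Matrix (Fin d) (Fin k) ℝ :=
  V.submatrix id (Fin.castLE hkr)

/-- `W_{S,:}`, the square submatrix of the rows of `W` with index in `S`, in increasing order. -/
def rowSubmatrix {d k : ℕ} (W : Matrix (Fin d) (Fin k) ℝ) (S : Finset (Fin d))
    (hS : S.card = k) : Matrix (Fin k) (Fin k) ℝ :=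
  W.submatrix (S.orderEmbOfFin hS) id

/-- `p`, the law of a random subset `Y` of `Fin d`, is a determinantal point process of marginal
kernel `K`: `ℙ(S ⊆ Y) = det K_S` for every `S`. -/
def IsDPP {d : ℕ} (p : PMF (Finset (Fin d))) (K : Matrix (Fin d) (Fin d) ℝ) : Prop :=
  ∀ S : Finset (Fin d),
    (∑ Y : Finset (Fin d) with S ⊆ Y, (p Y).toReal) =
      (K.submatrix (fun i : S => (i : Fin d)) (fun i : S => (i : Fin d))).det

/-- The expectation of `f Y` for a random subset `Y` of `Fin d` with law `p`. -/
noncomputable def expectation {d : ℕ} (p : PMF (Finset (Fin d))) (f : Finset (Fin d) → ℝ) : ℝ :=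
  ∑ Y : Finset (Fin d), (p Y).toReal * f Y

theorem exists_closest {E : Type*} [NormedAddCommGroup E] [NormedSpace ℝ E]
    [FiniteDimensional ℝ E] (C : Set E) (hC : IsClosed C) (hne : C.Nonempty) (x : E) :
    ∃ a ∈ C, ∀ b ∈ C, ‖x - a‖ ≤ ‖x - b‖ := by
  have := FiniteDimensional.proper ℝ E
  obtain ⟨a, ha, h⟩ := hC.exists_infDist_eq_dist hne x
  refine ⟨a, ha, fun b hb => ?_⟩
  rw [← dist_eq_norm, ← dist_eq_norm, ← h]
  exact Metric.infDist_le_dist_of_mem hb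

theorem isClosed_rank_le {m n : ℕ} {E : Type*} [NormedAddCommGroup E] [NormedSpace ℝ E]
    [FiniteDimensional ℝ E] (e : E →ₗ[ℝ] Matrix (Fin m) (Fin n) ℝ) (k : ℕ) :
    IsClosed {x : E | (e x).rank ≤ k} := by
  let g : E →ₗ[ℝ] ((Fin n → ℝ) →L[ℝ] (Fin m → ℝ)) :=
    (LinearMap.toContinuousLinearMap.toLinearMap ∘ₗ (Matrix.toLin'.toLinearMap)) ∘ₗ e
  have h1 := (isOpen_setOfPred_nat_le_rank (𝕜 := ℝ) (E := Fin n → ℝ) (F := Fin m → ℝ) (k+1)).preimage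
    (LinearMap.continuous_of_finiteDimensional g)
  rw [← isOpen_compl_iff]
  convert h1 using 1
  ext x
  simp only [Set.mem_compl_iff, Set.mem_ofPred_eq, not_le, Set.mem_preimage]
  have : (e x).rank = Module.finrank ℝ (LinearMap.range (Matrix.toLin' (e x))) := by
    rw [Matrix.rank, Matrix.toLin'_apply']
  rw [this]
  change _ ↔ ((k+1 : ℕ) : Cardinal) ≤ (Matrix.toLin' (e x)).rank
  rw [LinearMap.rank, ← Module.finrank_eq_rank, Nat.cast_le]
  rfl

/-- Best approximations of rank at most `k` exist. -/
theorem exists_isBestRankApprox {N d : ℕ} (ν : NormKind) (k : ℕ)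
    (X : Matrix (Fin N) (Fin d) ℝ) : ∃ A, IsBestRankApprox ν k X A := by
  cases ν with
  | spectral =>
    let _ := Matrix.instL2OpNormedAddCommGroup (m := Fin N) (n := Fin d) (𝕜 := ℝ)
    let _ := Matrix.instL2OpNormedSpace (m := Fin N) (n := Fin d) (𝕜 := ℝ)
    exact exists_closest {A : Matrix (Fin N) (Fin d) ℝ | A.rank ≤ k}
      (isClosed_rank_le ⟨⟨fun A => A, fun _ _ => rfl⟩, fun _ _ => rfl⟩ k) ⟨0, by simp⟩ X
  | frobenius =>
    let _ := Matrix.frobeniusNormedAddCommGroup (m := Fin N) (n := Fin d) (α := ℝ)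
    let _ := Matrix.frobeniusNormedSpace (m := Fin N) (n := Fin d) (R := ℝ) (α := ℝ)
    exact exists_closest {A : Matrix (Fin N) (Fin d) ℝ | A.rank ≤ k}
      (isClosed_rank_le ⟨⟨fun A => A, fun _ _ => rfl⟩, fun _ _ => rfl⟩ k) ⟨0, by simp⟩ X

/-- Best approximations from `k` given columns exist. -/
theorem exists_isBestColumnApprox {N d : ℕ} (ν : NormKind) (k : ℕ)
    (X : Matrix (Fin N) (Fin d) ℝ) (S : Finset (Fin d)) (hS : S.card = k) :
    ∃ A, IsBestColumnApprox ν k X S A := by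
  have hr : ∀ B : Matrix S (Fin d) ℝ, B.rank ≤ k := fun B =>
    (B.rank_le_card_height).trans (by simp [hS])
  let L : Matrix S (Fin d) ℝ →ₗ[ℝ] Matrix (Fin N) (Fin d) ℝ :=
    { toFun := fun B => colSubmatrix X S * B
      map_add' := fun a b => Matrix.mul_add _ a b
      map_smul' := fun c a => Matrix.mul_smul _ c a }
  have key : ∃ a ∈ (LinearMap.range L : Set (Matrix (Fin N) (Fin d) ℝ)),
      ∀ b ∈ (LinearMap.range L : Set (Matrix (Fin N) (Fin d) ℝ)),
        matNorm ν (X - a) ≤ matNorm ν (X - b) := by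
    cases ν with
    | spectral =>
      let _ := Matrix.instL2OpNormedAddCommGroup (m := Fin N) (n := Fin d) (𝕜 := ℝ)
      let _ := Matrix.instL2OpNormedSpace (m := Fin N) (n := Fin d) (𝕜 := ℝ)
      exact exists_closest _ (LinearMap.range L).closed_of_finiteDimensional ⟨0, by simp⟩ X
    | frobenius =>
      let _ := Matrix.frobeniusNormedAddCommGroup (m := Fin N) (n := Fin d) (α := ℝ)
      let _ := Matrix.frobeniusNormedSpace (m := Fin N) (n := Fin d) (R := ℝ) (α := ℝ)
      exact exists_closest _ (LinearMap.range L).closed_of_finiteDimensional ⟨0, by simp⟩ X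
  obtain ⟨a, ⟨B, rfl⟩, h⟩ := key
  exact ⟨_, ⟨B, hr B, rfl⟩, fun B' _ => h _ ⟨B', rfl⟩⟩

/-!
Let `W = V_k` and `K = W Wᵀ`. By Möbius inversion and the Cauchy–Binet formula, the only
determinantal point process of kernel `K` gives the weight `det K_S` to the sets `S` of cardinality
`k`, and no weight to the other ones.

If `det K_S ≠ 0`, let `P` be the projection onto the coordinates in `S` along the kernel of `Wᵀ`.
Then `X P` is a competitor of `Π_S X`, and `X - X P = (X - X K) (1 - P)` because `K P = K`. In both
norms the error is thus at most `‖X - X K‖ ‖1 - P‖` for the spectral norm of `1 - P`, and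
`‖1 - P‖ ≤ ‖P‖ ≤ ‖P‖_Fr` because `P` is a nonzero idempotent. The factor `det K_S` of the
expectation clears the denominator of `P`: since `K` is a projection,
`det K_S ‖P‖_Fr² = tr (adj K_S)`. This is the sum of the principal minors of `K` at `S \ {i}`, so
that summing over `S` counts each `T` with `k - 1` elements `d + 1 - k` times, and the principal
minors of size `k - 1` of `K` sum to those of `Wᵀ W = 1`, that is to `k`. The total is
`k (d + 1 - k) ‖X - X K‖²`, and by the Eckart–Young theorem `X K` is a best approximation of `X` of
rank at most `k` in both norms.
-/

section SubsetSums

open Finset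

variable {n R : Type*} [CommRing R]

theorem sum_powersetCard_sum_erase [DecidableEq n] (s : Finset n) (f : Finset n → R) (j : ℕ) :
    ∑ S ∈ s.powersetCard (j + 1), ∑ i ∈ S, f (S.erase i) =
      ((#s : R) - j) * ∑ T ∈ s.powersetCard j, f T := by
  calc
    _ = ∑ T ∈ s.powersetCard j, ∑ _i ∈ s \ T, f T := by
      rw [sum_sigma', sum_sigma']
      refine sum_bij' (fun x _ => ⟨x.1.erase x.2, x.2⟩) (fun x _ => ⟨insert x.2 x.1, x.2⟩)
        (by grind) (by grind) ?_ ?_ ?_ <;> rintro ⟨S, i⟩ h <;>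
        simp only [mem_sigma, mem_sdiff] at h
      · simp [insert_erase h.2]
      · simp [erase_insert h.2.2]
      · rfl
    _ = _ := by
      rw [mul_sum]
      refine sum_congr rfl fun T hT => ?_
      obtain ⟨hTs, rfl⟩ := mem_powersetCard.1 hT
      rw [sum_const, nsmul_eq_mul, card_sdiff_of_subset hTs, Nat.cast_sub (card_le_card hTs)]

variable [Fintype n]

theorem eq_of_sum_mul_prod_eq {f g : Finset n → R}
    (h : ∀ t : n → R, ∑ S, f S * ∏ i ∈ S, t i = ∑ S, g S * ∏ i ∈ S, t i) : f = g := by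
  classical
  have sum_indicator (f : Finset n → R) (A : Finset n) :
      ∑ S ∈ Iic A, f S = ∑ S, f S * ∏ i ∈ S, if i ∈ A then 1 else 0 := by
    simp [prod_ite_zero, sum_ite, ← subset_iff, Iic_eq_powerset, filter_subset_univ]
  ext S
  rw [IncidenceAlgebra.moebius_inversion_bot f _ fun _ => rfl,
    IncidenceAlgebra.moebius_inversion_bot g _ fun _ => rfl]
  simp_rw [sum_indicator, h]

theorem eq_of_sum_superset_eq [DecidableEq n] {f g : Finset n → R}
    (h : ∀ S, ∑ Y with S ⊆ Y, f Y = ∑ Y with S ⊆ Y, g Y) : f = g := by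
  have Ici_eq (S : Finset n) : Ici S = ({Y | S ⊆ Y} : Finset _) := by ext; simp
  ext S
  rw [IncidenceAlgebra.moebius_inversion_top f _ fun _ => rfl,
    IncidenceAlgebra.moebius_inversion_top g _ fun _ => rfl]
  simp_rw [Ici_eq, h]

end SubsetSums

section PrincipalMinors

open Finset Matrix

variable {m n R : Type*} [CommRing R]

/-- The principal submatrix of `K` with rows and columns in `S`. -/
abbrev principalSubmatrix (K : Matrix n n R) (S : Finset n) : Matrix S S R :=
  K.submatrix Subtype.val Subtype.val

variable [DecidableEq n]

/-- The principal minor of `K` with rows and columns in `S`; it is `1` for `S = ∅`. -/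
def principalMinor (K : Matrix n n R) (S : Finset n) : R :=
  (principalSubmatrix K S).det

theorem principalMinor_one (S : Finset n) : principalMinor (1 : Matrix n n R) S = 1 := by
  rw [principalMinor, principalSubmatrix, submatrix_one _ Subtype.val_injective, det_one]

theorem principalMinor_submatrix [DecidableEq m] (K : Matrix n n R) (f : m ↪ n) (T : Finset m) :
    principalMinor (K.submatrix f f) T = principalMinor K (T.map f) := by
  rw [principalMinor, principalMinor, ← det_submatrix_equiv_self (T.equivMap f)]
  rfl

theorem trace_adjugate_eq_sum_principalMinor [Fintype n] (K : Matrix n n R) :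
    K.adjugate.trace = ∑ i, principalMinor K (univ.erase i) := by
  refine sum_congr rfl fun i _ => ?_
  rw [diag_apply, adjugate_apply, principalMinor, ← det_piecewise_one_eq_submatrix_det]
  congr 1
  ext a b
  by_cases h : a = i
  · simp [h, one_apply, Pi.single_apply, eq_comm]
  · simp [h]

theorem trace_adjugate_principalSubmatrix (K : Matrix n n R) (S : Finset n) :
    (principalSubmatrix K S).adjugate.trace = ∑ i ∈ S, principalMinor K (S.erase i) := by
  rw [trace_adjugate_eq_sum_principalMinor,
    ← sum_coe_sort S fun i => principalMinor K (S.erase i)]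
  refine sum_congr rfl fun i _ => ?_
  have map_erase_univ : (univ.erase i).map (.subtype (· ∈ S)) = S.erase i := by
    rw [map_erase, univ_eq_attach, attach_map_val, Function.Embedding.subtype_apply]
  rw [← map_erase_univ]
  exact principalMinor_submatrix K (.subtype (· ∈ S)) _

variable [Fintype n]

theorem principalMinor_univ (K : Matrix n n R) : principalMinor K univ = K.det :=
  det_submatrix_equiv_self (Equiv.subtypeUnivEquiv mem_univ) K

theorem principalMinor_diagonal_mul (t : n → R) (K : Matrix n n R) (S : Finset n) :
    principalMinor (diagonal t * K) S = (∏ i ∈ S, t i) * principalMinor K S := by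
  rw [principalMinor, principalMinor, ← prod_coe_sort S t, ← det_diagonal, ← det_mul]
  congr 1
  ext i j
  simp [diagonal_mul]

theorem det_one_add_eq_sum_principalMinor (K : Matrix n n R) :
    (1 + K).det = ∑ S, principalMinor K S := by
  rw [add_comm]
  calc (K + 1).det = ∑ S : Finset n, (of (S.piecewise K.row (1 : Matrix n n R).row)).det :=
        (detRowAlternating (R := R) (n := n)).map_add_univ K.row (1 : Matrix n n R).row
    _ = ∑ S, principalMinor K S :=
        sum_congr rfl fun S _ => det_piecewise_one_eq_submatrix_det K S

theorem sum_principalMinor_mul_comm [Fintype m] [DecidableEq m] (A : Matrix m n R)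
    (B : Matrix n m R) (j : ℕ) :
    ∑ S ∈ univ.powersetCard j, principalMinor (A * B) S =
      ∑ S ∈ univ.powersetCard j, principalMinor (B * A) S := by
  simp only [principalMinor, ← coeff_det_one_add_X_smul_eq_sum_minors]
  rw [Matrix.map_mul, Matrix.map_mul, ← Matrix.smul_mul, det_one_add_mul_comm, Matrix.mul_smul]

end PrincipalMinors

section ProjectionDPP

open Finset Matrix

variable {n κ R : Type*} [Fintype n] [DecidableEq n] [Fintype κ] [CommRing R]

/-- The weight of `Y` in the determinantal point process of kernel `W Wᵀ`, for a matrix `W` with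
orthonormal columns: the squared maximal minor of `W` with rows in `Y`, written as a principal
minor of the kernel so that the rows need not be ordered. -/
def projectionWeight (W : Matrix n κ R) (Y : Finset n) : R :=
  if #Y = Fintype.card κ then principalMinor (W * Wᵀ) Y else 0

theorem sum_projectionWeight_mul (W : Matrix n κ R) (f : Finset n → R) :
    ∑ Y, projectionWeight W Y * f Y =
      ∑ Y ∈ univ.powersetCard (Fintype.card κ), principalMinor (W * Wᵀ) Y * f Y := by
  simp only [projectionWeight, ite_mul, zero_mul, powersetCard_eq_filter, powerset_univ,
    sum_filter]

variable [DecidableEq κ]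

theorem det_transpose_mul_diagonal_mul (W : Matrix n κ R) (t : n → R) :
    (Wᵀ * diagonal t * W).det = ∑ Y, projectionWeight W Y * ∏ i ∈ Y, t i := by
  have maximal_minor : (Wᵀ * diagonal t * W).det =
      ∑ S ∈ univ.powersetCard (Fintype.card κ), principalMinor (Wᵀ * (diagonal t * W)) S := by
    rw [← card_univ, powersetCard_self, sum_singleton, principalMinor_univ, Matrix.mul_assoc]
  rw [maximal_minor, sum_principalMinor_mul_comm, sum_projectionWeight_mul]
  simp_rw [Matrix.mul_assoc, principalMinor_diagonal_mul, mul_comm]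

theorem sum_principalMinor_mul_transpose {W : Matrix n κ R} (hW : Wᵀ * W = 1) (j : ℕ) :
    ∑ S ∈ univ.powersetCard j, principalMinor (W * Wᵀ) S = (Fintype.card κ).choose j := by
  rw [sum_principalMinor_mul_comm, hW]
  simp [principalMinor_one]

theorem sum_projectionWeight {W : Matrix n κ R} (hW : Wᵀ * W = 1) :
    ∑ Y, projectionWeight W Y = 1 := by
  simpa [hW] using (det_transpose_mul_diagonal_mul W 1).symm

theorem sum_trace_adjugate_principalSubmatrix {W : Matrix n κ R} (hW : Wᵀ * W = 1) :
    ∑ S ∈ univ.powersetCard (Fintype.card κ), (principalSubmatrix (W * Wᵀ) S).adjugate.trace =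
      (Fintype.card κ : R) * (Fintype.card n + 1 - Fintype.card κ) := by
  simp_rw [trace_adjugate_principalSubmatrix]
  cases hk : Fintype.card κ with
  | zero => simp
  | succ j =>
    rw [sum_powersetCard_sum_erase, sum_principalMinor_mul_transpose hW, hk,
      Nat.choose_succ_self_right, card_univ]
    push_cast
    ring

/-- Both sides are the coefficient of `∏ i ∈ S, t i` in
`det (Wᵀ * diagonal (1 + t) * W) = det (1 + diagonal t * (W * Wᵀ))`. -/
theorem sum_superset_projectionWeight {W : Matrix n κ R} (hW : Wᵀ * W = 1) (S : Finset n) :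
    ∑ Y with S ⊆ Y, projectionWeight W Y = principalMinor (W * Wᵀ) S := by
  revert S
  refine congrFun (eq_of_sum_mul_prod_eq fun t => ?_)
  calc ∑ S, (∑ Y with S ⊆ Y, projectionWeight W Y) * ∏ i ∈ S, t i
      = ∑ Y, projectionWeight W Y * ∏ i ∈ Y, (1 + t i) := by
        simp_rw [prod_one_add, sum_mul, mul_sum]
        exact sum_comm' (by simp)
    _ = (Wᵀ * diagonal (1 + t) * W).det := (det_transpose_mul_diagonal_mul W (1 + t)).symm
    _ = (1 + diagonal t * (W * Wᵀ)).det := by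
        rw [Pi.add_def, ← diagonal_add, Pi.one_def, diagonal_one, Matrix.mul_add,
          Matrix.add_mul, Matrix.mul_one, hW, Matrix.mul_assoc, det_one_add_mul_comm,
          Matrix.mul_assoc]
    _ = ∑ S, principalMinor (W * Wᵀ) S * ∏ i ∈ S, t i := by
        simp_rw [det_one_add_eq_sum_principalMinor, principalMinor_diagonal_mul, mul_comm]

end ProjectionDPP

section RealProjectionDPP

open Finset Matrix

open scoped ComplexOrder in
theorem principalMinor_nonneg {n 𝕜 : Type*} [DecidableEq n] [RCLike 𝕜] {K : Matrix n n 𝕜}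
    (hK : K.PosSemidef) (S : Finset n) : 0 ≤ principalMinor K S :=
  (hK.submatrix Subtype.val).det_nonneg

theorem posSemidef_mul_transpose {m n : Type*} [Finite m] [Fintype n] (A : Matrix m n ℝ) :
    (A * Aᵀ).PosSemidef :=
  posSemidef_self_mul_conjTranspose A

theorem projectionWeight_nonneg {n κ : Type*} [Finite n] [DecidableEq n] [Fintype κ]
    (W : Matrix n κ ℝ) (Y : Finset n) : 0 ≤ projectionWeight W Y := by
  unfold projectionWeight
  split_ifs
  exacts [principalMinor_nonneg (posSemidef_mul_transpose W) Y, le_rfl]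

variable {d k : ℕ} {W : Matrix (Fin d) (Fin k) ℝ}

theorem sq_det_rowSubmatrix (W : Matrix (Fin d) (Fin k) ℝ) (S : Finset (Fin d)) (hS : #S = k) :
    (rowSubmatrix W S hS).det ^ 2 = principalMinor (W * Wᵀ) S := by
  calc (rowSubmatrix W S hS).det ^ 2 = (rowSubmatrix W S hS * (rowSubmatrix W S hS)ᵀ).det := by
        rw [det_mul, det_transpose, sq]
    _ = principalMinor (W * Wᵀ) S :=
        det_submatrix_equiv_self (S.orderIsoOfFin hS).toEquiv (principalSubmatrix (W * Wᵀ) S)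

theorem isDPP_mul_transpose_iff (hW : Wᵀ * W = 1) (p : PMF (Finset (Fin d))) :
    IsDPP p (W * Wᵀ) ↔ ∀ Y, (p Y).toReal = projectionWeight W Y := by
  have superset_sum_eq (S : Finset (Fin d)) : _ = ((W * Wᵀ).submatrix _ _).det :=
    sum_superset_projectionWeight hW S
  simp only [IsDPP, ← superset_sum_eq]
  exact ⟨fun h => congrFun (eq_of_sum_superset_eq h), fun h S => sum_congr rfl fun Y _ => h Y⟩

theorem exists_isDPP_mul_transpose (hW : Wᵀ * W = 1) :
    ∃ p : PMF (Finset (Fin d)), IsDPP p (W * Wᵀ) := by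
  refine ⟨PMF.ofFintype (fun Y => ENNReal.ofReal (projectionWeight W Y)) ?_,
    (isDPP_mul_transpose_iff hW _).2 fun Y => ?_⟩
  · rw [← ENNReal.ofReal_sum_of_nonneg fun Y _ => projectionWeight_nonneg W Y,
      sum_projectionWeight hW, ENNReal.ofReal_one]
  · rw [PMF.ofFintype_apply, ENNReal.toReal_ofReal (projectionWeight_nonneg W Y)]

variable {p : PMF (Finset (Fin d))}

theorem IsDPP.apply_eq_zero (hp : IsDPP p (W * Wᵀ)) (hW : Wᵀ * W = 1) {S : Finset (Fin d)}
    (hS : #S ≠ k) : p S = 0 := by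
  have weight_eq := (isDPP_mul_transpose_iff hW p).1 hp S
  rw [projectionWeight, if_neg (by simpa using hS), ENNReal.toReal_eq_zero_iff] at weight_eq
  exact weight_eq.resolve_right (p.apply_ne_top S)

theorem IsDPP.toReal_apply (hp : IsDPP p (W * Wᵀ)) (hW : Wᵀ * W = 1) {S : Finset (Fin d)}
    (hS : #S = k) : (p S).toReal = (rowSubmatrix W S hS).det ^ 2 := by
  rw [(isDPP_mul_transpose_iff hW p).1 hp, projectionWeight, if_pos (by simpa using hS),
    sq_det_rowSubmatrix]

theorem IsDPP.expectation_eq (hp : IsDPP p (W * Wᵀ)) (hW : Wᵀ * W = 1)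
    (f : Finset (Fin d) → ℝ) :
    expectation p f = ∑ S ∈ univ.powersetCard k, principalMinor (W * Wᵀ) S * f S := by
  simp_rw [expectation, (isDPP_mul_transpose_iff hW p).1 hp]
  simpa using sum_projectionWeight_mul W f

end RealProjectionDPP

section IdempotentNorm

variable {𝕜 E : Type*} [RCLike 𝕜] [NormedAddCommGroup E] [InnerProductSpace 𝕜 E]

theorem norm_sq_smul_add_sq_smul (u v : E) :
    ‖((‖v‖ ^ 2 : ℝ) : 𝕜) • u + ((‖u‖ ^ 2 : ℝ) : 𝕜) • v‖ = ‖u‖ * ‖v‖ * ‖u + v‖ := by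
  refine (sq_eq_sq₀ (norm_nonneg _) (by positivity)).1 ?_
  rw [mul_pow, norm_add_sq (𝕜 := 𝕜), norm_add_sq (𝕜 := 𝕜) u v, inner_smul_left, inner_smul_right,
    RCLike.conj_ofReal, RCLike.re_ofReal_mul, RCLike.re_ofReal_mul, norm_smul, norm_smul,
    RCLike.norm_of_nonneg (sq_nonneg _), RCLike.norm_of_nonneg (sq_nonneg _)]
  ring

theorem one_le_norm_of_isIdempotentElem {A : Type*} [NormedRing A] {a : A}
    (ha : IsIdempotentElem a) (h0 : a ≠ 0) : 1 ≤ ‖a‖ := by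
  refine le_of_mul_le_mul_right ?_ (norm_pos_iff.2 h0)
  calc 1 * ‖a‖ = ‖a * a‖ := by rw [one_mul, ha.eq]
    _ ≤ ‖a‖ * ‖a‖ := norm_mul_le a a

/-- Swapping the lengths of the two components `u = P x` and `v = x - P x` does not change the norm
of their sum, and turns the image under `P` into a vector of the length of `v`. -/
theorem norm_one_sub_le_of_isIdempotentElem {P : E →L[𝕜] E} (hP : IsIdempotentElem P)
    (h0 : P ≠ 0) : ‖1 - P‖ ≤ ‖P‖ := by
  refine ContinuousLinearMap.opNorm_le_bound _ (norm_nonneg P) fun x => ?_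
  obtain ⟨u, hu⟩ : ∃ u, P x = u := ⟨_, rfl⟩
  obtain ⟨v, hv⟩ : ∃ v, x - P x = v := ⟨_, rfl⟩
  change ‖x - P x‖ ≤ ‖P‖ * ‖x‖
  have x_eq : x = u + v := by rw [← hu, ← hv, add_sub_cancel]
  have map_u : P u = u := by rw [← hu]; exact DFunLike.congr_fun hP x
  have map_v : P v = 0 := by rw [← hv, map_sub, hu, map_u, sub_self]
  rw [hv]
  rcases eq_or_ne u 0 with rfl | u_ne
  · rw [x_eq, zero_add]
    exact le_mul_of_one_le_left (norm_nonneg v) (one_le_norm_of_isIdempotentElem hP h0)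
  rcases eq_or_ne v 0 with rfl | v_ne
  · simpa using by positivity
  refine le_of_mul_le_mul_left ?_ (mul_pos (norm_pos_iff.2 u_ne) (norm_pos_iff.2 v_ne))
  calc ‖u‖ * ‖v‖ * ‖v‖ = ‖P (((‖v‖ ^ 2 : ℝ) : 𝕜) • u + ((‖u‖ ^ 2 : ℝ) : 𝕜) • v)‖ := by
        rw [map_add, map_smul, map_smul, map_u, map_v, smul_zero, add_zero, norm_smul,
          RCLike.norm_of_nonneg (sq_nonneg _)]
        ring
    _ ≤ ‖P‖ * (‖u‖ * ‖v‖ * ‖u + v‖) := by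
        rw [← norm_sq_smul_add_sq_smul (𝕜 := 𝕜)]
        exact P.le_opNorm _
    _ = ‖u‖ * ‖v‖ * (‖P‖ * ‖x‖) := by
        rw [x_eq]
        ring

end IdempotentNorm

section MatrixNorms

open Matrix WithLp

variable {l m n : Type*} [Fintype l] [Fintype m] [Fintype n]

section Frobenius

open scoped Matrix.Norms.Frobenius

theorem frobenius_norm_sq (A : Matrix m n ℝ) : ‖A‖ ^ 2 = (Aᵀ * A).trace := by
  rw [frobenius_norm_def, ← Real.sqrt_eq_rpow, Real.sq_sqrt (by positivity), Finset.sum_comm]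
  simp [trace, mul_apply, sq]

theorem norm_toLp_mulVec_le_frobenius_norm {𝕜 : Type*} [RCLike 𝕜] (A : Matrix m n 𝕜) (v : n → 𝕜) :
    ‖toLp 2 (A *ᵥ v)‖ ≤ ‖A‖ * ‖toLp 2 v‖ := by
  simpa only [← frobenius_norm_replicateCol (ι := Unit), replicateCol_mulVec] using
    frobenius_norm_mul A (replicateCol Unit v)

end Frobenius

open scoped Matrix.Norms.L2Operator

theorem trace_transpose_mul_self_eq_sum_norm_sq (A : Matrix m n ℝ) :
    (Aᵀ * A).trace = ∑ j, ‖toLp 2 (A.col j)‖ ^ 2 := by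
  simp_rw [EuclideanSpace.real_norm_sq_eq, trace, diag_apply, mul_apply, sq]
  rfl

theorem trace_transpose_mul_mul_le [DecidableEq m] (A : Matrix l m ℝ) (B : Matrix m n ℝ) :
    ((A * B)ᵀ * (A * B)).trace ≤ ‖A‖ ^ 2 * (Bᵀ * B).trace := by
  simp_rw [trace_transpose_mul_self_eq_sum_norm_sq, Finset.mul_sum, ← mul_pow]
  exact Finset.sum_le_sum fun j _ =>
    pow_le_pow_left₀ (norm_nonneg _) (l2_opNorm_mulVec A (toLp 2 (B.col j))) 2

variable [DecidableEq n]

theorem l2_opNorm_sq_le_trace (A : Matrix m n ℝ) : ‖A‖ ^ 2 ≤ (Aᵀ * A).trace := by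
  rw [← frobenius_norm_sq]
  refine pow_le_pow_left₀ (norm_nonneg A) ?_ 2
  rw [l2_opNorm_def]
  refine ContinuousLinearMap.opNorm_le_bound _ ?_ fun x => ?_
  · exact @norm_nonneg _ frobeniusNormedAddCommGroup.toSeminormedAddCommGroup.toSeminormedAddGroup A
  · exact norm_toLp_mulVec_le_frobenius_norm A (ofLp x)

theorem l2_opNorm_transpose [DecidableEq m] (A : Matrix m n ℝ) : ‖Aᵀ‖ = ‖A‖ := by
  rw [← conjTranspose_eq_transpose_of_trivial, l2_opNorm_conjTranspose]

theorem trace_transpose_mul_le_mul_sq_norm (A : Matrix l m ℝ) (B : Matrix m n ℝ) :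
    ((A * B)ᵀ * (A * B)).trace ≤ (Aᵀ * A).trace * ‖B‖ ^ 2 := by
  classical
  simpa only [transpose_mul, transpose_transpose, trace_mul_comm _ (A * B), trace_mul_comm Aᵀ,
    l2_opNorm_transpose, mul_comm] using trace_transpose_mul_mul_le Bᵀ Aᵀ

theorem l2_opNorm_one_le {𝕜 : Type*} [RCLike 𝕜] : ‖(1 : Matrix n n 𝕜)‖ ≤ 1 := by
  rw [← diagonal_one, l2_opNorm_diagonal]
  exact (pi_norm_const_le (1 : 𝕜)).trans_eq norm_one

theorem l2_opNorm_le_one {U : Matrix m n ℝ} (hU : Uᵀ * U = 1) : ‖U‖ ≤ 1 := by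
  rw [← abs_norm, ← sq_le_one_iff_abs_le_one, sq, ← l2_opNorm_conjTranspose_mul_self,
    conjTranspose_eq_transpose_of_trivial, hU]
  exact l2_opNorm_one_le

theorem one_le_l2_opNorm_one_sub_of_rank_lt {𝕜 : Type*} [RCLike 𝕜] {B : Matrix n n 𝕜}
    (hB : B.rank < Fintype.card n) : 1 ≤ ‖1 - B‖ := by
  by_contra! norm_lt
  have isUnit_B : IsUnit B := by simpa using isUnit_one_sub_of_norm_lt_one norm_lt
  exact hB.ne (rank_of_isUnit B isUnit_B)

theorem l2_opNorm_one_sub_le_of_isIdempotentElem {𝕜 : Type*} [RCLike 𝕜] {P : Matrix n n 𝕜}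
    (hP : IsIdempotentElem P) (h0 : P ≠ 0) : ‖1 - P‖ ≤ ‖P‖ := by
  have norm_le := norm_one_sub_le_of_isIdempotentElem (hP.map (toEuclideanCLM (n := n) (𝕜 := 𝕜)))
    (by simpa using h0)
  rwa [← map_one (toEuclideanCLM (n := n) (𝕜 := 𝕜)), ← map_sub] at norm_le

end MatrixNorms

section MatNorm

open Matrix

variable {l m n : ℕ}

open scoped Matrix.Norms.L2Operator in
theorem matNorm_spectral (A : Matrix (Fin m) (Fin n) ℝ) : matNorm .spectral A = ‖A‖ :=
  rfl

theorem matNorm_frobenius_sq (A : Matrix (Fin m) (Fin n) ℝ) :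
    matNorm .frobenius A ^ 2 = (Aᵀ * A).trace :=
  frobenius_norm_sq A

theorem matNorm_nonneg (ν : NormKind) (A : Matrix (Fin m) (Fin n) ℝ) : 0 ≤ matNorm ν A := by
  cases ν
  · exact @norm_nonneg _ instL2OpNormedAddCommGroup.toSeminormedAddCommGroup.toSeminormedAddGroup A
  · exact @norm_nonneg _ frobeniusNormedAddCommGroup.toSeminormedAddCommGroup.toSeminormedAddGroup A

open scoped Matrix.Norms.L2Operator in
theorem matNorm_mul_sq_le (ν : NormKind) (A : Matrix (Fin l) (Fin m) ℝ)
    (B : Matrix (Fin m) (Fin n) ℝ) : matNorm ν (A * B) ^ 2 ≤ matNorm ν A ^ 2 * ‖B‖ ^ 2 := by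
  cases ν
  · simp_rw [matNorm_spectral, ← mul_pow]
    exact pow_le_pow_left₀ (norm_nonneg _) (l2_opNorm_mul A B) 2
  · simp_rw [matNorm_frobenius_sq]
    exact trace_transpose_mul_le_mul_sq_norm A B

end MatNorm

section EckartYoung

open Finset Matrix

open scoped Matrix.Norms.L2Operator

variable {m n r κ : Type*} [Fintype m] [Fintype n] [DecidableEq r]
  {U : Matrix m r ℝ} {V : Matrix n r ℝ}

theorem submatrix_transpose_mul_submatrix [DecidableEq κ] (hU : Uᵀ * U = 1) {e : κ → r}
    (he : e.Injective) : (U.submatrix id e)ᵀ * U.submatrix id e = 1 := by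
  calc _ = (Uᵀ * U).submatrix e e := rfl
    _ = 1 := by rw [hU, submatrix_one e he]

variable [Fintype r]

theorem l2_opNorm_mul_diagonal_mul_le [DecidableEq n] (hU : Uᵀ * U = 1) (hV : Vᵀ * V = 1)
    (τ : r → ℝ) : ‖U * diagonal τ * Vᵀ‖ ≤ ‖τ‖ := by
  calc ‖U * diagonal τ * Vᵀ‖ ≤ ‖U‖ * ‖diagonal τ‖ * ‖Vᵀ‖ :=
        (l2_opNorm_mul _ _).trans (by gcongr; exact l2_opNorm_mul _ _)
    _ ≤ 1 * ‖τ‖ * 1 := by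
        rw [l2_opNorm_diagonal, l2_opNorm_transpose]
        gcongr
        exacts [l2_opNorm_le_one hU, l2_opNorm_le_one hV]
    _ = ‖τ‖ := by rw [one_mul, mul_one]

/-- After compression to the chosen singular vectors and rescaling, `U * diagonal τ * Vᵀ` becomes
the identity, whose distance to a singular matrix is at least `1`. -/
theorem le_l2_opNorm_sub_of_rank_lt [Fintype κ] [DecidableEq n] (hU : Uᵀ * U = 1)
    (hV : Vᵀ * V = 1) {e : κ → r} (he : e.Injective) {τ : r → ℝ} {c : ℝ} (hc : 0 < c)
    (hτ : ∀ i, c ≤ τ (e i)) {A : Matrix m n ℝ} (hA : A.rank < Fintype.card κ) :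
    c ≤ ‖U * diagonal τ * Vᵀ - A‖ := by
  classical
  set L := diagonal (fun i => (τ (e i))⁻¹) * (U.submatrix id e)ᵀ
  set R := V.submatrix id e
  have compression : L * (U * diagonal τ * Vᵀ) * R = 1 := by
    calc L * (U * diagonal τ * Vᵀ) * R
        = diagonal (fun i => (τ (e i))⁻¹) * ((Uᵀ * U) * diagonal τ * (Vᵀ * V)).submatrix e e := by
          simp only [L, R, Matrix.mul_assoc]
          rfl
      _ = 1 := by
          rw [hU, hV, Matrix.one_mul, Matrix.mul_one, submatrix_diagonal _ _ he,
            diagonal_mul_diagonal, ← diagonal_one]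
          exact congrArg diagonal (funext fun i => inv_mul_cancel₀ (hc.trans_le (hτ i)).ne')
  have norm_L : ‖L‖ ≤ c⁻¹ := by
    refine (l2_opNorm_mul _ _).trans ?_
    rw [l2_opNorm_diagonal, l2_opNorm_transpose, ← mul_one c⁻¹]
    gcongr
    · refine (pi_norm_le_iff_of_nonneg (by positivity)).2 fun i => ?_
      rw [Real.norm_of_nonneg (inv_nonneg.2 (hc.le.trans (hτ i)))]
      exact inv_anti₀ hc (hτ i)
    · exact l2_opNorm_le_one (submatrix_transpose_mul_submatrix hU he)
  have norm_R : ‖R‖ ≤ 1 := l2_opNorm_le_one (submatrix_transpose_mul_submatrix hV he)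
  have rank_lt : (L * A * R).rank < Fintype.card κ :=
    ((rank_mul_le_left _ _).trans (rank_mul_le_right _ _)).trans_lt hA
  refine (one_le_inv_mul₀ hc).1 ?_
  calc 1 ≤ ‖1 - L * A * R‖ := one_le_l2_opNorm_one_sub_of_rank_lt rank_lt
    _ = ‖L * (U * diagonal τ * Vᵀ - A) * R‖ := by
        rw [← compression, Matrix.mul_sub, Matrix.sub_mul]
    _ ≤ ‖L‖ * ‖U * diagonal τ * Vᵀ - A‖ * ‖R‖ :=
        (l2_opNorm_mul _ _).trans (by gcongr; exact l2_opNorm_mul _ _)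
    _ ≤ c⁻¹ * ‖U * diagonal τ * Vᵀ - A‖ * 1 := by gcongr
    _ = c⁻¹ * ‖U * diagonal τ * Vᵀ - A‖ := mul_one _

theorem trace_transpose_mul_diagonal_mul (hV : Vᵀ * V = 1) (U : Matrix m r ℝ) (τ : r → ℝ)
    (G : Matrix m m ℝ) :
    ((U * diagonal τ * Vᵀ)ᵀ * G * (U * diagonal τ * Vᵀ)).trace =
      ∑ i, τ i ^ 2 * (Uᵀ * G * U) i i := by
  calc _ = (diagonal τ * (Uᵀ * G * U) * diagonal τ * (Vᵀ * V)).trace := by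
        rw [← Matrix.mul_assoc _ Vᵀ, trace_mul_comm _ V]
        simp only [transpose_mul, transpose_transpose, diagonal_transpose, Matrix.mul_assoc]
    _ = ∑ i, τ i ^ 2 * (Uᵀ * G * U) i i := by
        rw [hV, Matrix.mul_one]
        refine sum_congr rfl fun i _ => ?_
        rw [diag_apply, mul_diagonal, diagonal_mul]
        ring

theorem sum_compl_le_sum_mul_one_sub {a t : r → ℝ} {s : Finset r} {c : ℝ} (hc : 0 ≤ c)
    (ha : ∀ i ∈ s, c ≤ a i) (ha' : ∀ i ∉ s, a i ≤ c) (ht₀ : ∀ i, 0 ≤ t i) (ht₁ : ∀ i, t i ≤ 1)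
    (ht : ∑ i, t i ≤ #s) : ∑ i ∈ sᶜ, a i ≤ ∑ i, a i * (1 - t i) := by
  have on_s : ∑ i ∈ s, c * (1 - t i) ≤ ∑ i ∈ s, a i * (1 - t i) :=
    sum_le_sum fun i hi => mul_le_mul_of_nonneg_right (ha i hi) (sub_nonneg.2 (ht₁ i))
  have off_s : ∑ i ∈ sᶜ, (a i - c * t i) ≤ ∑ i ∈ sᶜ, a i * (1 - t i) :=
    sum_le_sum fun i hi => by
      nlinarith [mul_le_mul_of_nonneg_right (ha' i (mem_compl.1 hi)) (ht₀ i)]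
  have budget := mul_nonneg hc (sub_nonneg.2 ht)
  rw [← sum_add_sum_compl s] at budget ⊢
  simp only [← mul_sum, sum_sub_distrib, sum_const, nsmul_eq_mul, mul_one] at on_s off_s
  linarith

theorem exists_isStarProjection_mul_eq {𝕜 : Type*} [RCLike 𝕜] (A : Matrix m n 𝕜) :
    ∃ Q : Matrix m m 𝕜, IsStarProjection Q ∧ Q * A = A ∧ Q.trace = A.rank := by
  classical
  set T := LinearMap.range (toEuclideanLin A)
  obtain ⟨Q, hQ⟩ : ∃ Q : Matrix m m 𝕜, toEuclideanCLM (n := m) (𝕜 := 𝕜) Q = T.starProjection :=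
    (toEuclideanCLM (n := m) (𝕜 := 𝕜)).surjective _
  have Q_mulVec (v : EuclideanSpace 𝕜 m) : WithLp.toLp 2 (Q *ᵥ v.ofLp) = T.starProjection v := by
    rw [← hQ]
    rfl
  have isProj : LinearMap.IsProj T T.starProjection.toLinearMap :=
    ⟨fun x => T.starProjection_apply_mem x, fun x hx => T.starProjection_eq_self_iff.2 hx⟩
  refine ⟨Q, ?_, ?_, ?_⟩
  · rw [← StarAlgEquiv.symm_apply_apply (toEuclideanCLM (n := m) (𝕜 := 𝕜)) Q, hQ]
    exact isStarProjection_starProjection.map (toEuclideanCLM (n := m) (𝕜 := 𝕜)).symm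
  · refine Matrix.ext_of_mulVec_single fun j => ?_
    have col_mem : WithLp.toLp 2 (A *ᵥ Pi.single j 1) ∈ T := ⟨WithLp.toLp 2 (Pi.single j 1), rfl⟩
    rw [← mulVec_mulVec]
    exact (WithLp.toLp_injective 2) ((Q_mulVec _).trans (T.starProjection_eq_self_iff.2 col_mem))
  · rw [rank_eq_finrank_range_toLin A (EuclideanSpace.basisFun _ 𝕜).toBasis
      (EuclideanSpace.basisFun _ 𝕜).toBasis, ← toEuclideanLin_eq_toLin_orthonormal,
      ← isProj.trace, ← hQ, coe_toEuclideanCLM_eq_toEuclideanLin,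
      toEuclideanLin_eq_toLin_orthonormal, trace_toLin_eq]

section StarProjection

variable {Q : Matrix m m ℝ}

theorem transpose_mul_self_of_isStarProjection (hQ : IsStarProjection Q) : Qᵀ * Q = Q := by
  have transpose_Q : Qᵀ = Q := hQ.isSelfAdjoint
  rw [transpose_Q, hQ.isIdempotentElem.eq]

theorem transpose_mul_mul_of_isStarProjection {n : Type*} (hQ : IsStarProjection Q)
    (B : Matrix m n ℝ) : Bᵀ * Q * B = (Q * B)ᵀ * (Q * B) := by
  rw [transpose_mul, Matrix.mul_assoc _ Qᵀ, ← Matrix.mul_assoc Qᵀ,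
    transpose_mul_self_of_isStarProjection hQ, Matrix.mul_assoc]

theorem transpose_mul_mul_apply_self_nonneg {n : Type*} [Finite n]
    (hQ : IsStarProjection Q) (B : Matrix m n ℝ) (i : n) : 0 ≤ (Bᵀ * Q * B) i i := by
  rw [transpose_mul_mul_of_isStarProjection hQ]
  exact (posSemidef_conjTranspose_mul_self (Q * B)).diag_nonneg

theorem trace_transpose_mul_mul_le_trace (hQ : IsStarProjection Q) (hU : Uᵀ * U = 1) :
    (Uᵀ * Q * U).trace ≤ Q.trace := by
  calc (Uᵀ * Q * U).trace = ((Q * U)ᵀ * (Q * U)).trace := by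
        rw [transpose_mul_mul_of_isStarProjection hQ]
    _ ≤ (Qᵀ * Q).trace * ‖U‖ ^ 2 := trace_transpose_mul_le_mul_sq_norm Q U
    _ ≤ (Qᵀ * Q).trace :=
        mul_le_of_le_one_right (posSemidef_conjTranspose_mul_self Q).trace_nonneg
          (pow_le_one₀ (norm_nonneg U) (l2_opNorm_le_one hU))
    _ = Q.trace := by rw [transpose_mul_self_of_isStarProjection hQ]

theorem trace_transpose_mul_one_sub_mul_le [DecidableEq m] (hQ : IsStarProjection Q)
    {A : Matrix m n ℝ} (hA : Q * A = A) (X : Matrix m n ℝ) :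
    (Xᵀ * (1 - Q) * X).trace ≤ ((X - A)ᵀ * (X - A)).trace := by
  have mul_sub_eq : (1 - Q) * (X - A) = (1 - Q) * X := by
    rw [Matrix.mul_sub, Matrix.sub_mul 1 Q A, hA, Matrix.one_mul, sub_self, sub_zero]
  calc (Xᵀ * (1 - Q) * X).trace = (((1 - Q) * (X - A))ᵀ * ((1 - Q) * (X - A))).trace := by
        rw [transpose_mul_mul_of_isStarProjection hQ.one_sub, mul_sub_eq]
    _ ≤ ‖1 - Q‖ ^ 2 * ((X - A)ᵀ * (X - A)).trace := trace_transpose_mul_mul_le _ _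
    _ ≤ ((X - A)ᵀ * (X - A)).trace :=
        mul_le_of_le_one_left (posSemidef_conjTranspose_mul_self (X - A)).trace_nonneg
          (pow_le_one₀ (norm_nonneg _) hQ.one_sub.norm_le)

end StarProjection

theorem sum_compl_le_trace_sub_of_rank_le (hU : Uᵀ * U = 1) (hV : Vᵀ * V = 1) {τ : r → ℝ}
    {s : Finset r} {c : ℝ} (hc : 0 ≤ c) (hτ : ∀ i ∈ s, c ≤ τ i ^ 2) (hτ' : ∀ i ∉ s, τ i ^ 2 ≤ c)
    {A : Matrix m n ℝ} (hA : A.rank ≤ #s) :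
    ∑ i ∈ sᶜ, τ i ^ 2 ≤ ((U * diagonal τ * Vᵀ - A)ᵀ * (U * diagonal τ * Vᵀ - A)).trace := by
  classical
  obtain ⟨Q, hQ, hQA, trace_Q⟩ := exists_isStarProjection_mul_eq A
  have diag_one_sub (i : r) : (Uᵀ * (1 - Q) * U : Matrix r r ℝ) i i = 1 - (Uᵀ * Q * U) i i := by
    rw [Matrix.mul_sub, Matrix.sub_mul, Matrix.mul_one, hU, Matrix.sub_apply, one_apply_eq]
  have diag_le_one (i : r) : (Uᵀ * Q * U) i i ≤ 1 := by
    rw [← sub_nonneg, ← diag_one_sub]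
    exact transpose_mul_mul_apply_self_nonneg hQ.one_sub U i
  have sum_diag_le : ∑ i, (Uᵀ * Q * U) i i ≤ #s := by
    refine (trace_transpose_mul_mul_le_trace hQ hU).trans ?_
    rw [trace_Q]
    exact_mod_cast hA
  calc ∑ i ∈ sᶜ, τ i ^ 2 ≤ ∑ i, τ i ^ 2 * (1 - (Uᵀ * Q * U) i i) :=
        sum_compl_le_sum_mul_one_sub hc hτ hτ'
          (transpose_mul_mul_apply_self_nonneg hQ U) diag_le_one sum_diag_le
    _ = ((U * diagonal τ * Vᵀ)ᵀ * (1 - Q) * (U * diagonal τ * Vᵀ)).trace := by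
        simp_rw [trace_transpose_mul_diagonal_mul hV, diag_one_sub]
    _ ≤ _ := trace_transpose_mul_one_sub_mul_le hQ hQA _

end EckartYoung

section TruncatedSVD

open Finset Matrix

variable {N d r k : ℕ} {X : Matrix (Fin N) (Fin d) ℝ} {U : Matrix (Fin N) (Fin r) ℝ}
  {σ : Fin r → ℝ} {V : Matrix (Fin d) (Fin r) ℝ}

theorem firstCols_mul_transpose (hkr : k ≤ r) (V : Matrix (Fin d) (Fin r) ℝ) :
    firstCols hkr V * (firstCols hkr V)ᵀ =
      V * diagonal (fun i : Fin r => if i < k then (1 : ℝ) else 0) * Vᵀ := by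
  obtain ⟨m, rfl⟩ := Nat.exists_eq_add_of_le hkr
  ext i j
  rw [mul_apply, mul_apply, Fin.sum_univ_add]
  simp [mul_diagonal, firstCols, Fin.castLE, Fin.castAdd]

theorem IsSVD.sub_mul_firstCols (h : IsSVD X U σ V) (hkr : k ≤ r) :
    X - X * (firstCols hkr V * (firstCols hkr V)ᵀ) =
      U * diagonal (fun i : Fin r => if i < k then 0 else σ i) * Vᵀ := by
  have truncation : X * (firstCols hkr V * (firstCols hkr V)ᵀ) =
      U * diagonal (fun i : Fin r => if i < k then σ i else 0) * Vᵀ := by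
    calc X * (firstCols hkr V * (firstCols hkr V)ᵀ)
        = U * (diagonal σ * (Vᵀ * V) *
            diagonal (fun i : Fin r => if i < k then (1 : ℝ) else 0)) * Vᵀ := by
          rw [firstCols_mul_transpose, h.eq]
          simp only [Matrix.mul_assoc]
      _ = _ := by
          rw [h.orthonormal_right, Matrix.mul_one, diagonal_mul_diagonal]
          simp only [mul_ite, mul_one, mul_zero]
  rw [truncation, h.eq, ← Matrix.sub_mul, ← Matrix.mul_sub, diagonal_sub]
  congr! 4 with i
  split_ifs
  exacts [sub_self _, sub_zero _]

theorem IsSVD.spectral_sub_mul_firstCols_le (h : IsSVD X U σ V) (hkr : k ≤ r)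
    {A : Matrix (Fin N) (Fin d) ℝ} (hA : A.rank ≤ k) :
    matNorm .spectral (X - X * (firstCols hkr V * (firstCols hkr V)ᵀ)) ≤
      matNorm .spectral (X - A) := by
  rw [h.sub_mul_firstCols]
  refine (l2_opNorm_mul_diagonal_mul_le h.orthonormal_left h.orthonormal_right _).trans ?_
  refine (pi_norm_le_iff_of_nonneg (matNorm_nonneg _ _)).2 fun i => ?_
  split_ifs with hi
  · rw [norm_zero]
    exact matNorm_nonneg _ _
  · rw [Real.norm_of_nonneg (h.pos i).le, h.eq]
    have hir : k + 1 ≤ r := by omega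
    refine le_l2_opNorm_sub_of_rank_lt h.orthonormal_left h.orthonormal_right
      (Fin.castLE_injective hir) (h.pos i) (fun j => h.antitone ?_)
      (by simpa [Nat.lt_succ_iff] using hA)
    exact Fin.le_def.2 (by simp; omega)

theorem IsSVD.exists_sq_threshold (h : IsSVD X U σ V) (k : ℕ) :
    ∃ c, 0 ≤ c ∧ (∀ i : Fin r, i < k → c ≤ σ i ^ 2) ∧ ∀ i : Fin r, k ≤ i → σ i ^ 2 ≤ c := by
  have antitone_sq {i j : Fin r} (hij : i ≤ j) : σ j ^ 2 ≤ σ i ^ 2 :=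
    pow_le_pow_left₀ (h.pos j).le (h.antitone hij) 2
  by_cases hk : k < r
  · exact ⟨σ ⟨k, hk⟩ ^ 2, sq_nonneg _, fun i hi => antitone_sq (Fin.le_def.2 hi.le),
      fun i hi => antitone_sq (Fin.le_def.2 hi)⟩
  · exact ⟨0, le_rfl, fun i _ => sq_nonneg _, fun i hi => absurd i.isLt (by omega)⟩

theorem IsSVD.frobenius_sub_mul_firstCols_le (h : IsSVD X U σ V) (hkr : k ≤ r)
    {A : Matrix (Fin N) (Fin d) ℝ} (hA : A.rank ≤ k) :
    matNorm .frobenius (X - X * (firstCols hkr V * (firstCols hkr V)ᵀ)) ≤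
      matNorm .frobenius (X - A) := by
  refine (sq_le_sq₀ (matNorm_nonneg _ _) (matNorm_nonneg _ _)).1 ?_
  set s : Finset (Fin r) := {i | i < k} with hs
  have card_s : #s = k := by rw [hs, Fin.card_filter_val_lt, min_eq_right hkr]
  obtain ⟨c, hc, on_s, off_s⟩ := h.exists_sq_threshold k
  calc matNorm .frobenius (X - X * (firstCols hkr V * (firstCols hkr V)ᵀ)) ^ 2
      = ∑ i ∈ sᶜ, σ i ^ 2 := by
        have trace_eq := trace_transpose_mul_diagonal_mul h.orthonormal_right U
          (fun i : Fin r => if i < k then 0 else σ i) 1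
        rw [Matrix.mul_one, Matrix.mul_one, h.orthonormal_left] at trace_eq
        rw [matNorm_frobenius_sq, h.sub_mul_firstCols, trace_eq, hs]
        simp [ite_pow, sum_ite, compl_filter]
    _ ≤ matNorm .frobenius (X - A) ^ 2 := by
        rw [matNorm_frobenius_sq, h.eq]
        exact sum_compl_le_trace_sub_of_rank_le h.orthonormal_left h.orthonormal_right hc
          (fun i hi => on_s i (by simpa [hs] using hi))
          (fun i hi => off_s i (by simpa [hs] using hi)) (hA.trans_eq card_s.symm)

theorem IsSVD.isBestRankApprox_mul_firstCols (h : IsSVD X U σ V) (hkr : k ≤ r) (ν : NormKind) :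
    IsBestRankApprox ν k X (X * (firstCols hkr V * (firstCols hkr V)ᵀ)) := by
  refine ⟨?_, fun A hA => ?_⟩
  · exact (rank_mul_le_right _ _).trans ((rank_mul_le_left _ _).trans (rank_le_width _))
  · cases ν
    exacts [h.spectral_sub_mul_firstCols_le hkr hA, h.frobenius_sub_mul_firstCols_le hkr hA]

end TruncatedSVD

section ObliqueProjection

open Finset Matrix

variable {n κ R : Type*} [DecidableEq n] [CommRing R]

/-- The inclusion of the coordinates in `S`; multiplying by it on the right selects columns. -/
def coordinateInclusion (R : Type*) [CommRing R] (S : Finset n) : Matrix n S R :=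
  (1 : Matrix n n R).submatrix id Subtype.val

/-- The left inverse of `coordinateInclusion R S` whose kernel is that of the rows of `K` with index
in `S`; it is `0` if the principal minor of `K` at `S` is not invertible. -/
noncomputable def coordinateRetraction (K : Matrix n n R) (S : Finset n) : Matrix S n R :=
  (principalSubmatrix K S)⁻¹ * K.submatrix (Subtype.val : S → n) id

variable [Fintype n]

theorem mul_coordinateInclusion {l : Type*} (M : Matrix l n R) (S : Finset n) :
    M * coordinateInclusion R S = M.submatrix id Subtype.val :=
  mul_submatrix_one (Equiv.refl n) Subtype.val M

/-- For `K = W Wᵀ` with `#S` columns in `W`, this is the projection onto the coordinates in `S`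
along the kernel of `Wᵀ`. -/
noncomputable def obliqueProjection (K : Matrix n n R) (S : Finset n) : Matrix n n R :=
  coordinateInclusion R S * coordinateRetraction K S

variable {K : Matrix n n R} {S : Finset n}

theorem coordinateRetraction_mul_coordinateInclusion (hS : IsUnit (principalMinor K S)) :
    coordinateRetraction K S * coordinateInclusion R S = 1 := by
  rw [coordinateRetraction, Matrix.mul_assoc, mul_coordinateInclusion]
  exact nonsing_inv_mul _ hS

theorem isIdempotentElem_obliqueProjection (hS : IsUnit (principalMinor K S)) :
    IsIdempotentElem (obliqueProjection K S) := by
  rw [IsIdempotentElem, obliqueProjection, Matrix.mul_assoc,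
    ← Matrix.mul_assoc (coordinateRetraction K S),
    coordinateRetraction_mul_coordinateInclusion hS, Matrix.one_mul]

theorem coordinateRetraction_mul_transpose (hK : Kᵀ = K) (hKK : K * K = K)
    (hS : IsUnit (principalMinor K S)) :
    coordinateRetraction K S * (coordinateRetraction K S)ᵀ = (principalSubmatrix K S)⁻¹ := by
  have gram : K.submatrix (Subtype.val : S → n) id * (K.submatrix (Subtype.val : S → n) id)ᵀ =
      principalSubmatrix K S := by
    calc _ = (K * Kᵀ).submatrix Subtype.val Subtype.val := rfl
      _ = principalSubmatrix K S := by rw [hK, hKK]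
  have transpose_principal : (principalSubmatrix K S)ᵀ = principalSubmatrix K S := by
    rw [transpose_submatrix, hK]
  rw [coordinateRetraction, transpose_mul, transpose_nonsing_inv, transpose_principal,
    Matrix.mul_assoc, ← Matrix.mul_assoc _ _ (_⁻¹), gram, mul_nonsing_inv _ hS, Matrix.mul_one]

theorem principalMinor_mul_trace_obliqueProjection (hK : Kᵀ = K) (hKK : K * K = K)
    (hS : IsUnit (principalMinor K S)) :
    principalMinor K S * ((obliqueProjection K S)ᵀ * obliqueProjection K S).trace =
      (principalSubmatrix K S).adjugate.trace := by
  have inclusion_isometry : (coordinateInclusion R S)ᵀ * coordinateInclusion R S = 1 := by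
    calc _ = (1 : Matrix n n R)ᵀ.submatrix (Subtype.val : S → n) Subtype.val := by
          rw [mul_coordinateInclusion]
          rfl
      _ = 1 := by rw [transpose_one, submatrix_one _ Subtype.val_injective]
  calc principalMinor K S * ((obliqueProjection K S)ᵀ * obliqueProjection K S).trace
      = principalMinor K S * (coordinateRetraction K S * (coordinateRetraction K S)ᵀ).trace := by
        rw [obliqueProjection, transpose_mul, Matrix.mul_assoc,
          ← Matrix.mul_assoc (coordinateInclusion R S)ᵀ,
          inclusion_isometry, Matrix.one_mul, trace_mul_comm]
    _ = (principalSubmatrix K S).adjugate.trace := by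
        rw [coordinateRetraction_mul_transpose hK hKK hS, Matrix.inv_def, trace_smul, smul_eq_mul,
          ← mul_assoc, ← principalMinor, Ring.mul_inverse_cancel _ hS, one_mul]

theorem mul_transpose_mul_obliqueProjection [Fintype κ] {W : Matrix n κ R}
    (hcard : #S = Fintype.card κ) (hS : IsUnit (principalMinor (W * Wᵀ) S)) :
    W * Wᵀ * obliqueProjection (W * Wᵀ) S = W * Wᵀ := by
  classical
  set Y : Matrix S κ R := W.submatrix Subtype.val id
  have equiv : S ≃ κ := Fintype.equivOfCardEq (by rw [Fintype.card_coe, hcard])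
  have left_inverse : Yᵀ * ((Y * Yᵀ)⁻¹ * Y) = 1 := by
    rw [← Matrix.mul_assoc, ← mul_eq_one_comm_of_equiv equiv, ← Matrix.mul_assoc]
    exact mul_nonsing_inv _ hS
  calc W * Wᵀ * obliqueProjection (W * Wᵀ) S = W * Yᵀ * ((Y * Yᵀ)⁻¹ * (Y * Wᵀ)) := by
        rw [obliqueProjection, coordinateRetraction, ← Matrix.mul_assoc, mul_coordinateInclusion]
        rfl
    _ = W * (Yᵀ * ((Y * Yᵀ)⁻¹ * Y)) * Wᵀ := by simp only [Matrix.mul_assoc]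
    _ = W * Wᵀ := by rw [left_inverse, Matrix.mul_one]

theorem sub_mul_obliqueProjection [Fintype κ] {l : Type*} (X : Matrix l n R) {W : Matrix n κ R}
    (hcard : #S = Fintype.card κ) (hS : IsUnit (principalMinor (W * Wᵀ) S)) :
    X - X * obliqueProjection (W * Wᵀ) S =
      (X - X * (W * Wᵀ)) * (1 - obliqueProjection (W * Wᵀ) S) := by
  rw [Matrix.mul_sub, Matrix.mul_one, Matrix.sub_mul, Matrix.mul_assoc X,
    mul_transpose_mul_obliqueProjection hcard hS, sub_sub_sub_cancel_right]

end ObliqueProjection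

section ColumnSelection

open Finset Matrix

open scoped Matrix.Norms.L2Operator

theorem card_le_card_of_transpose_mul_eq_one {n κ R : Type*} [Fintype n] [Fintype κ]
    [DecidableEq κ] [CommRing R] [Nontrivial R] {W : Matrix n κ R} (hW : Wᵀ * W = 1) :
    Fintype.card κ ≤ Fintype.card n := by
  rw [← rank_one (R := R) (n := κ), ← hW]
  exact (rank_mul_le_left _ _).trans (rank_le_card_width _)

theorem principalMinor_mul_sq_norm_one_sub_obliqueProjection_le {n κ : Type*} [Fintype n]
    [DecidableEq n] [Fintype κ] [DecidableEq κ] [Nonempty κ] {W : Matrix n κ ℝ} (hW : Wᵀ * W = 1)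
    {S : Finset n} (hcard : #S = Fintype.card κ) (hS : IsUnit (principalMinor (W * Wᵀ) S)) :
    principalMinor (W * Wᵀ) S * ‖1 - obliqueProjection (W * Wᵀ) S‖ ^ 2 ≤
      (principalSubmatrix (W * Wᵀ) S).adjugate.trace := by
  have symmetric : (W * Wᵀ)ᵀ = W * Wᵀ := by rw [transpose_mul, transpose_transpose]
  have idempotent : W * Wᵀ * (W * Wᵀ) = W * Wᵀ := by
    rw [Matrix.mul_assoc, ← Matrix.mul_assoc Wᵀ, hW, Matrix.one_mul]
  have projection_ne_zero : obliqueProjection (W * Wᵀ) S ≠ 0 := fun projection_eq_zero => by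
    have kernel_eq_zero := mul_transpose_mul_obliqueProjection hcard hS
    rw [projection_eq_zero, Matrix.mul_zero] at kernel_eq_zero
    have trace_kernel := trace_mul_comm W Wᵀ
    rw [← kernel_eq_zero, hW, trace_zero, trace_one] at trace_kernel
    exact Fintype.card_ne_zero (α := κ) (by exact_mod_cast trace_kernel.symm)
  calc principalMinor (W * Wᵀ) S * ‖1 - obliqueProjection (W * Wᵀ) S‖ ^ 2
      ≤ principalMinor (W * Wᵀ) S *
          ((obliqueProjection (W * Wᵀ) S)ᵀ * obliqueProjection (W * Wᵀ) S).trace := by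
        refine mul_le_mul_of_nonneg_left ?_ (principalMinor_nonneg (posSemidef_mul_transpose W) S)
        refine le_trans (pow_le_pow_left₀ (norm_nonneg _) ?_ 2) (l2_opNorm_sq_le_trace _)
        exact l2_opNorm_one_sub_le_of_isIdempotentElem (isIdempotentElem_obliqueProjection hS)
          projection_ne_zero
    _ = (principalSubmatrix (W * Wᵀ) S).adjugate.trace :=
        principalMinor_mul_trace_obliqueProjection symmetric idempotent hS

variable {N d k : ℕ} {W : Matrix (Fin d) (Fin k) ℝ} {ν : NormKind}
  {X : Matrix (Fin N) (Fin d) ℝ}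

theorem principalMinor_mul_sq_matNorm_sub_le (hW : Wᵀ * W = 1) (hk : 1 ≤ k) {S : Finset (Fin d)}
    (hS : #S = k) {A : Matrix (Fin N) (Fin d) ℝ} (hA : IsBestColumnApprox ν k X S A) :
    principalMinor (W * Wᵀ) S * matNorm ν (X - A) ^ 2 ≤
      (principalSubmatrix (W * Wᵀ) S).adjugate.trace * matNorm ν (X - X * (W * Wᵀ)) ^ 2 := by
  have minor_nonneg := principalMinor_nonneg (posSemidef_mul_transpose W)
  have hcard : #S = Fintype.card (Fin k) := by rw [hS, Fintype.card_fin]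
  rcases eq_or_ne (principalMinor (W * Wᵀ) S) 0 with minor_eq_zero | minor_ne_zero
  · rw [minor_eq_zero, zero_mul, trace_adjugate_principalSubmatrix]
    exact mul_nonneg (sum_nonneg fun i _ => minor_nonneg _) (sq_nonneg _)
  have : Nonempty (Fin k) := ⟨⟨0, hk⟩⟩
  have error_le : matNorm ν (X - A) ≤ matNorm ν (X - X * obliqueProjection (W * Wᵀ) S) := by
    have column_error_le := hA.2 (coordinateRetraction (W * Wᵀ) S)
      ((rank_le_card_height _).trans (by rw [Fintype.card_coe, hS]))
    rwa [colSubmatrix, ← mul_coordinateInclusion, Matrix.mul_assoc] at column_error_le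
  rw [sub_mul_obliqueProjection X hcard minor_ne_zero.isUnit] at error_le
  calc principalMinor (W * Wᵀ) S * matNorm ν (X - A) ^ 2
      ≤ principalMinor (W * Wᵀ) S * (matNorm ν (X - X * (W * Wᵀ)) ^ 2 *
          ‖1 - obliqueProjection (W * Wᵀ) S‖ ^ 2) :=
        mul_le_mul_of_nonneg_left
          ((pow_le_pow_left₀ (matNorm_nonneg _ _) error_le 2).trans (matNorm_mul_sq_le _ _ _))
          (minor_nonneg S)
    _ ≤ _ := by
        rw [mul_left_comm, mul_comm]
        exact mul_le_mul_of_nonneg_right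
          (principalMinor_mul_sq_norm_one_sub_obliqueProjection_le hW hcard minor_ne_zero.isUnit)
          (sq_nonneg _)

theorem IsDPP.expectation_sq_matNorm_sub_le {p : PMF (Finset (Fin d))} (hp : IsDPP p (W * Wᵀ))
    (hW : Wᵀ * W = 1) (hk : 1 ≤ k) {XS : Finset (Fin d) → Matrix (Fin N) (Fin d) ℝ}
    (hXS : ∀ S, #S = k → IsBestColumnApprox ν k X S (XS S)) :
    expectation p (fun S => matNorm ν (X - XS S) ^ 2) ≤
      k * (d + 1 - k) * matNorm ν (X - X * (W * Wᵀ)) ^ 2 := by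
  have sum_trace := sum_trace_adjugate_principalSubmatrix hW
  simp only [Fintype.card_fin] at sum_trace
  rw [hp.expectation_eq hW, ← sum_trace, sum_mul]
  refine sum_le_sum fun S hS => ?_
  have card_S := (mem_powersetCard.1 hS).2
  exact principalMinor_mul_sq_matNorm_sub_le hW hk card_S (hXS S card_S)

end ColumnSelection

theorem mainTheorem1 {N d r k : ℕ} (X : Matrix (Fin N) (Fin d) ℝ)
    (U : Matrix (Fin N) (Fin r) ℝ) (σ : Fin r → ℝ) (V : Matrix (Fin d) (Fin r) ℝ)
    (hSVD : IsSVD X U σ V) (hk : 1 ≤ k) (hkr : k ≤ r) :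
    (∃ p : PMF (Finset (Fin d)), IsDPP p (firstCols hkr V * (firstCols hkr V).transpose)) ∧
    ∀ p : PMF (Finset (Fin d)), IsDPP p (firstCols hkr V * (firstCols hkr V).transpose) →
      (∀ S : Finset (Fin d), S.card ≠ k → p S = 0) ∧
      (∀ (S : Finset (Fin d)) (hS : S.card = k),
        (p S).toReal = (rowSubmatrix (firstCols hkr V) S hS).det ^ 2) ∧
      ∀ (ν μ : NormKind) (Xk : Matrix (Fin N) (Fin d) ℝ)
        (XS : Finset (Fin d) → Matrix (Fin N) (Fin d) ℝ),
        IsBestRankApprox μ k X Xk →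
        (∀ S : Finset (Fin d), S.card = k → IsBestColumnApprox ν k X S (XS S)) →
        expectation p (fun S => matNorm ν (X - XS S) ^ 2) ≤
          (k : ℝ) * ((d : ℝ) + 1 - (k : ℝ)) * matNorm ν (X - Xk) ^ 2 := by
  have orthonormal := submatrix_transpose_mul_submatrix hSVD.orthonormal_right
    (Fin.castLE_injective hkr)
  refine ⟨exists_isDPP_mul_transpose orthonormal, fun p hp =>
    ⟨fun S hS => hp.apply_eq_zero orthonormal hS, fun S hS => hp.toReal_apply orthonormal hS, ?_⟩⟩
  intro ν μ Xk XS hXk hXS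
  have k_le_d : (k : ℝ) ≤ d := by
    simpa using card_le_card_of_transpose_mul_eq_one orthonormal
  have truncation_le := (hSVD.isBestRankApprox_mul_firstCols hkr ν).2 Xk hXk.1
  refine (hp.expectation_sq_matNorm_sub_le orthonormal hk hXS).trans ?_
  exact mul_le_mul_of_nonneg_left (pow_le_pow_left₀ (matNorm_nonneg _ _) truncation_le 2)
    (mul_nonneg k.cast_nonneg (by linarith))
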